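/- Let $H$ be a separable real Hilbert space, let $(\Omega,\mathcal F,P)$ be a probability space, and let $Z\subset H$ be nonempty and closed, with distance function $d_Z(y)=\inf_{z\in Z}\|y-z\|$. Let $(x_n)_{n\in\mathbb N}$ be a sequence of $H$-valued random variables generated as follows: $x_0\in L^2(\Omega,\mathcal F,P;H)$ and, for every $n\in\mathbb N$, with $\mathcal X_n=\sigma(x_0,\dots,x_n)$, one takes $\lambda_n\in L^\infty(\Omega,\mathcal F,P;\left]0,+\infty\right[)$, $d_n\in L^2(\Omega,\mathcal F,P;H)$, and $\delta_n\colon\Omega\times H\to[0,+\infty[$ such that $$E\big(\lambda_n(2-\lambda_n)\|d_n\|^2\,\big|\,\mathcal X_n\big)\ge 0\ \text{ a.s.},\qquad (\forall z\in Z)\quad E\big(\lambda_n\langle z+d_n-x_n,d_n\rangle\,\big|\,\mathcal X_n\big)\le\delta_n(\cdot,z)/2\ \text{ a.s.},$$ and sets $x_{n+1}=x_n-\lambda_nd_n$ a.s. Here $\delta_n$ is a Carathéodory integrand (that is, $\delta_n(\omega,\cdot)$ is continuous for almost every $\omega$ and $\delta_n(\cdot,z)$ is $\mathcal F$-measurable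 for every $z\in H$) such that $E\,\delta_n(\cdot,y)<+\infty$ for every $y\in L^2(\Omega,\mathcal F,P;H)$. Suppose that, for every $n$, $\delta_n(\omega,z)$ does not depend on $z$, and write $\vartheta_n(\omega)=\delta_n(\omega,0)$. Then $x_n\in L^2(\Omega,\mathcal F,P;H)$ for every $n$, and the following hold: (i) For every $n\in\mathbb N$, $E(d_Z^2(x_{n+1})\mid\mathcal X_n)\le d_Z^2(x_n)+\vartheta_n$ a.s. (ii) For every $n\in\mathbb N$, $E\,d_Z^2(x_{n+1})\le E\,d_Z^2(x_n)+E\,\vartheta_n$. (iii) If $\sum_{n}\vartheta_n<+\infty$ a.s., then $(d_Z(x_n))_{n\in\mathbb N}$ converges a.s. (iv) Suppose that $\sum_{n}E\,\vartheta_n<+\infty$. Then: (a) $(E\,d_Z^2(x_n))_{n\in\mathbb N}$ converges. (b) If $Z$ is convex and $\liminf_n E\,d_Z^2(x_n)=0$, then $(x_n)_{n\in\mathbb N}$ converges strongly in $L^2(\Omega,\mathcal F,P;H)$ and strongly a.s. to a $Z$-valued random variable. (c) Suppose that $Z$ is convex and that there exists $\chi\in\left]0,1\right[$ such that, for every $n\in\mathbb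 N$, $E(d_Z^2(x_{n+1})\mid\mathcal X_n)\le\chi\,d_Z^2(x_n)+\vartheta_n$ a.s. Then: [A] For every $n\in\mathbb N$, $E\,d_Z^2(x_{n+1})\le\chi^{n+1}E\,d_Z^2(x_0)+\sum_{j=0}^{n}\chi^{n-j}E\,\vartheta_j$. [B] There exists a $Z$-valued random variable $x\in L^2(\Omega,\mathcal F,P;H)$ such that $(x_n)_{n\in\mathbb N}$ converges to $x$ strongly in $L^2(\Omega,\mathcal F,P;H)$ and strongly a.s., and $$(\forall n\in\mathbb N)\quad E\|x_n-x\|^2\le 4\chi^nE\,d_Z^2(x_0)+4\sum_{j=0}^{n-1}\chi^{n-j-1}E\,\vartheta_j+2\sum_{j\ge n}E\,\vartheta_j.$$ -/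

import Mathlib

open MeasureTheory Filter Topology

/-- The sub-`σ`-algebra `σ(x₀, …, xₙ)` generated by the first `n + 1` terms of a sequence of
`H`-valued random variables. -/
@[reducible] def pastSigmaAlgebra {Ω H : Type*} [TopologicalSpace H] (x : ℕ → Ω → H) (n : ℕ) :
    MeasurableSpace Ω :=
  ⨆ j ≤ n, MeasurableSpace.comap (x j) (borel H)

/-- Nonnegative Carathéodory integrands `φ : Ω × H → [0, ∞)` such that `E φ(·, y) < ∞` for every
`y ∈ L²(Ω; H)`. -/
structure IsCaratheodoryIntegrand {Ω H : Type*} [MeasurableSpace Ω] [NormedAddCommGroup H]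
    (μ : Measure Ω) (φ : Ω → H → ℝ) : Prop where
  nonneg : ∀ ω z, 0 ≤ φ ω z
  continuous : ∀ᵐ ω ∂μ, Continuous (φ ω)
  measurable : ∀ z, Measurable fun ω => φ ω z
  integrable : ∀ y : Ω → H, MemLp y 2 μ → Integrable (fun ω => φ ω (y ω)) μ

/-- `x` is a sequence of random variables generated by the abstract stochastic algorithm with
target set `Z`, relaxations `lam`, directions `d` and tolerances `δ`. Elements of `Lᵖ` spaces are
represented by functions, so that relations between them hold almost surely. -/
structure IsGeneratedSequence {Ω H : Type*} [MeasurableSpace Ω] [NormedAddCommGroup H]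
    [InnerProductSpace ℝ H] [MeasurableSpace H] (μ : Measure Ω) (Z : Set H)
    (x : ℕ → Ω → H) (lam : ℕ → Ω → ℝ) (d : ℕ → Ω → H) (δ : ℕ → Ω → H → ℝ) : Prop where
  measurable : ∀ n, Measurable (x n)
  memLp_zero : MemLp (x 0) 2 μ
  memLp_lam : ∀ n, MemLp (lam n) ⊤ μ
  lam_pos : ∀ n, ∀ᵐ ω ∂μ, 0 < lam n ω
  memLp_d : ∀ n, MemLp (d n) 2 μ
  tolerance : ∀ n, IsCaratheodoryIntegrand μ (δ n)
  condExp_nonneg : ∀ n,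
    ∀ᵐ ω ∂μ, 0 ≤ (μ[fun ω => lam n ω * (2 - lam n ω) * ‖d n ω‖ ^ 2 | pastSigmaAlgebra x n]) ω
  condExp_le : ∀ n, ∀ z ∈ Z,
    ∀ᵐ ω ∂μ, (μ[fun ω => lam n ω * inner ℝ (z + d n ω - x n ω) (d n ω) |
      pastSigmaAlgebra x n]) ω ≤ δ n ω z / 2
  update : ∀ n, ∀ᵐ ω ∂μ, x (n + 1) ω = x n ω - lam n ω • d n ω

/-! Expanding `‖x (n+1) - z‖ ^ 2` and conditioning on the past gives, for each `z ∈ Z`, a Fejér-type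
inequality whose error `ϑ n` does not depend on `z` (`IsQuasiFejer`). The infimum over a countable
dense subset of `Z` turns it into the same inequality for `d_Z ^ 2`. This is (i); integrating yields
(ii) and (iv)(a), and a Robbins–Siegmund argument yields (iii).

For strong convergence, the inequality is transferred from fixed points of `Z` to random points
measurable with respect to the past, in particular to the projection of `x n`. Comparing `x (n+k)`
and `x n` with that projection gives `E‖x (n+k) - x n‖² ≤ 4 E d_Z²(x n) + 2 ∑_{j ≥ n} E ϑ j`. Hence
the sequence is Cauchy in `L²` once `E d_Z²(x n) → 0`, and letting `k → ∞` gives the rate. Almost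
sure convergence follows from that of a subsequence, since `‖x n - z‖` converges a.s. for all `z` in
a countable dense subset of `Z`. In (c), the contraction forces `E d_Z²(x n) → 0`. -/

/-! ### Almost supermartingales -/

/-- A weak form of the Robbins–Siegmund theorem: an adapted nonnegative integrable sequence which
is a supermartingale up to a nonnegative adapted perturbation `c` converges almost surely on the
event that `∑ c n` is finite. -/
theorem ae_tendsto_of_condExp_succ_le_add {Ω : Type*} {mΩ : MeasurableSpace Ω} {μ : Measure Ω}
    [IsFiniteMeasure μ] {ℱ : Filtration ℕ mΩ} {a c : ℕ → Ω → ℝ}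
    (ha : ∀ n, StronglyMeasurable[ℱ n] (a n)) (hai : ∀ n, Integrable (a n) μ)
    (ha0 : ∀ n ω, 0 ≤ a n ω) (hc : ∀ n, StronglyMeasurable[ℱ n] (c n)) (hc0 : ∀ n ω, 0 ≤ c n ω)
    (h : ∀ n, ∀ᵐ ω ∂μ, (μ[a (n + 1) | ℱ n]) ω ≤ a n ω + c n ω) :
    ∀ᵐ ω ∂μ, Summable (fun n => c n ω) → ∃ l : ℝ, Tendsto (fun n => a n ω) atTop (𝓝 l) := by
  let C : ℕ → Ω → ℝ := fun n ω => ∑ j ∈ Finset.range n, c j ω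
  have hCm : ∀ n, StronglyMeasurable[ℱ n] (C (n + 1)) := fun n =>
    Finset.stronglyMeasurable_fun_sum _ fun j hj =>
      (hc j).mono (ℱ.mono (Nat.lt_succ_iff.1 (Finset.mem_range.1 hj)))
  have hCm' : ∀ n, StronglyMeasurable[ℱ n] (C n) := fun n =>
    Finset.stronglyMeasurable_fun_sum _ fun j hj =>
      (hc j).mono (ℱ.mono (Finset.mem_range.1 hj).le)
  have hCmono : ∀ n ω, C n ω ≤ C (n + 1) ω := fun n ω => by
    simp only [C, Finset.sum_range_succ]; linarith [hc0 n ω]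
  have key : ∀ k : ℕ, ∀ᵐ ω ∂μ, (∀ n, C n ω ≤ k) → Summable (fun n => c n ω) →
      ∃ l : ℝ, Tendsto (fun n => a n ω) atTop (𝓝 l) := by
    intro k
    -- Localization: the process is killed once the accumulated perturbation exceeds `k`. As `C (n +
    -- 1)` only involves `c 0, …, c n`, the factor `g (n + 1)` is already known at time `n`.
    let g : ℕ → Ω → ℝ := fun n => {ω | C n ω ≤ k}.indicator fun _ => 1
    let e : ℕ → Ω → ℝ := fun n ω => g (n + 1) ω * c n ω
    let S : ℕ → Ω → ℝ := fun n ω => ∑ j ∈ Finset.range n, e j ω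
    let N : ℕ → Ω → ℝ := fun n ω => g n ω * a n ω - S n ω
    have hgm : ∀ n, StronglyMeasurable[ℱ n] (g (n + 1)) := fun n =>
      stronglyMeasurable_const.indicator ((hCm n).measurable measurableSet_Iic)
    have hgm' : ∀ n, StronglyMeasurable[ℱ n] (g n) := fun n =>
      stronglyMeasurable_const.indicator ((hCm' n).measurable measurableSet_Iic)
    have hg1 : ∀ n ω, C n ω ≤ k → g n ω = 1 := fun n ω hω =>
      Set.indicator_of_mem (s := {ω | C n ω ≤ k}) hω _
    have hg2 : ∀ n ω, ¬ C n ω ≤ k → g n ω = 0 := fun n ω hω =>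
      Set.indicator_of_notMem (s := {ω | C n ω ≤ k}) hω _
    have hg01 : ∀ n ω, 0 ≤ g n ω ∧ g n ω ≤ 1 := fun n ω => by
      by_cases hω : C n ω ≤ k
      · simp [hg1 n ω hω]
      · simp [hg2 n ω hω]
    have hganti : ∀ n ω, g (n + 1) ω ≤ g n ω := fun n ω => by
      by_cases hω : C (n + 1) ω ≤ k
      · rw [hg1 _ _ hω, hg1 _ _ ((hCmono n ω).trans hω)]
      · rw [hg2 _ _ hω]; exact (hg01 n ω).1
    have he0 : ∀ n ω, 0 ≤ e n ω := fun n ω => mul_nonneg (hg01 _ _).1 (hc0 _ _)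
    have hS0 : ∀ n ω, 0 ≤ S n ω := fun n ω => Finset.sum_nonneg fun j _ => he0 j ω
    have hSk : ∀ n ω, S n ω ≤ C n ω ∧ S n ω ≤ k := by
      intro n ω
      induction n with
      | zero => simp [S, C]
      | succ n ih =>
        have h1 : S (n + 1) ω = S n ω + e n ω := Finset.sum_range_succ ..
        have h2 : C (n + 1) ω = C n ω + c n ω := Finset.sum_range_succ ..
        by_cases hω : C (n + 1) ω ≤ k
        · have h3 : e n ω = c n ω := by simp [e, hg1 _ _ hω]
          constructor <;> linarith [ih.1]
        · have h3 : e n ω = 0 := by simp [e, hg2 _ _ hω]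
          constructor <;> linarith [ih.1, ih.2, hc0 n ω]
    have hem : ∀ n, StronglyMeasurable[ℱ n] (e n) := fun n => (hgm n).mul (hc n)
    have hSm : ∀ n, StronglyMeasurable[ℱ n] (S (n + 1)) := fun n =>
      Finset.stronglyMeasurable_fun_sum _ fun j hj =>
        (hem j).mono (ℱ.mono (Nat.lt_succ_iff.1 (Finset.mem_range.1 hj)))
    have hSm' : ∀ n, StronglyMeasurable[ℱ n] (S n) := fun n =>
      Finset.stronglyMeasurable_fun_sum _ fun j hj =>
        (hem j).mono (ℱ.mono (Finset.mem_range.1 hj).le)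
    have hSi : ∀ n, Integrable (S n) μ := fun n =>
      Integrable.of_bound ((hSm' n).mono (ℱ.le n)).aestronglyMeasurable k
        (Eventually.of_forall fun ω => by
          rw [Real.norm_of_nonneg (hS0 n ω)]; exact (hSk n ω).2)
    have hgai : ∀ n m, Integrable (fun ω => g n ω * a m ω) μ := fun n m =>
      (hai m).bdd_mul (c := 1) ((hgm' n).mono (ℱ.le n)).aestronglyMeasurable
        (Eventually.of_forall fun ω => by
          rw [Real.norm_of_nonneg (hg01 n ω).1]; exact (hg01 n ω).2)
    have hNi : ∀ n, Integrable (N n) μ := fun n => (hgai n n).sub (hSi n)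
    have hN : Supermartingale N ℱ μ := by
      refine supermartingale_nat (fun n => ((hgm' n).mul (ha n)).sub (hSm' n)) hNi fun n => ?_
      have e1 := condExp_sub (hgai (n + 1) (n + 1)) (hSi (n + 1)) (ℱ n)
      have e2 := condExp_mul_of_stronglyMeasurable_left (hgm n) (hgai (n + 1) (n + 1))
        (hai (n + 1))
      have e3 := condExp_of_stronglyMeasurable (ℱ.le n) (hSm n) (hSi (n + 1))
      filter_upwards [e1, e2, h n] with ω h1 h2 h3
      have h4 : (μ[N (n + 1) | ℱ n]) ω
          = g (n + 1) ω * (μ[a (n + 1) | ℱ n]) ω - S (n + 1) ω := by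
        refine h1.trans ?_
        rw [Pi.sub_apply, e3]
        exact congrArg (· - _) h2
      have h5 : S (n + 1) ω = S n ω + g (n + 1) ω * c n ω := Finset.sum_range_succ ..
      have h6 := mul_le_mul_of_nonneg_left h3 (hg01 (n + 1) ω).1
      have h7 := mul_le_mul_of_nonneg_right (hganti n ω) (ha0 n ω)
      rw [h4]
      change _ ≤ g n ω * a n ω - S n ω
      linarith
    obtain ⟨R, hR⟩ : ∃ R : NNReal, ∀ n, eLpNorm ((-N) n) 1 μ ≤ R := by
      -- Since `N n ≥ -k`, one has `|N n| ≤ N n + 2 * k`, and the means of `N` decrease.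
      refine ⟨(∫ ω, N 0 ω ∂μ + ∫ _, (2 * k : ℝ) ∂μ).toNNReal, fun n => ?_⟩
      change eLpNorm (-N n) 1 μ ≤ _
      rw [eLpNorm_one_eq_lintegral_enorm, ← ofReal_integral_norm_eq_lintegral_enorm (hNi n).neg]
      refine ENNReal.ofReal_le_ofReal ?_
      have h1 : ∫ ω, N n ω ∂μ ≤ ∫ ω, N 0 ω ∂μ := by
        simpa using hN.setIntegral_le (Nat.zero_le n) MeasurableSet.univ
      calc ∫ ω, ‖(-N) n ω‖ ∂μ ≤ ∫ ω, (N n ω + 2 * k) ∂μ := by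
            refine integral_mono (hNi n).neg.norm ((hNi n).add (integrable_const _)) fun ω => ?_
            change ‖-N n ω‖ ≤ N n ω + 2 * k
            rw [norm_neg, Real.norm_eq_abs, abs_le]
            have h2 : N n ω = g n ω * a n ω - S n ω := rfl
            have h3 := mul_nonneg (hg01 n ω).1 (ha0 n ω)
            have h4 := (hSk n ω).2
            have h5 : (0 : ℝ) ≤ k := k.cast_nonneg
            constructor <;> linarith
        _ = ∫ ω, N n ω ∂μ + ∫ _, (2 * k : ℝ) ∂μ :=
            integral_add (hNi n) (integrable_const _)
        _ ≤ _ := by linarith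
    filter_upwards [hN.neg.exists_ae_tendsto_of_bdd hR] with ω ⟨l, hl⟩ hk hs
    refine ⟨-l + ∑' n, c n ω, ?_⟩
    refine (hl.neg.add hs.hasSum.tendsto_sum_nat).congr fun n => ?_
    have h1 : S n ω = C n ω := Finset.sum_congr rfl fun j _ => by simp [e, hg1 _ _ (hk _)]
    have h2 : N n ω = a n ω - C n ω := by simp [N, hg1 _ _ (hk _), h1]
    change -(-N n ω) + C n ω = a n ω
    linarith
  filter_upwards [ae_all_iff.2 key] with ω hω hs
  obtain ⟨k, hk⟩ := exists_nat_ge (∑' n, c n ω)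
  exact hω k (fun n => (hs.sum_le_tsum _ fun j _ => hc0 j ω).trans hk) hs

/-- The perturbation in `ae_tendsto_of_condExp_succ_le_add` need not be adapted. -/
theorem ae_tendsto_of_condExp_succ_le_add' {Ω : Type*} {mΩ : MeasurableSpace Ω} {μ : Measure Ω}
    [IsFiniteMeasure μ] {ℱ : Filtration ℕ mΩ} {a θ : ℕ → Ω → ℝ}
    (ha : ∀ n, StronglyMeasurable[ℱ n] (a n)) (hai : ∀ n, Integrable (a n) μ)
    (ha0 : ∀ n ω, 0 ≤ a n ω) (hθ0 : ∀ n ω, 0 ≤ θ n ω)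
    (h : ∀ n, ∀ᵐ ω ∂μ, (μ[a (n + 1) | ℱ n]) ω ≤ a n ω + θ n ω) :
    ∀ᵐ ω ∂μ, Summable (fun n => θ n ω) → ∃ l : ℝ, Tendsto (fun n => a n ω) atTop (𝓝 l) := by
  -- The smallest nonnegative adapted perturbation that works; it lies a.s. below `θ`, so it
  -- inherits summability.
  let c : ℕ → Ω → ℝ := fun n ω => max ((μ[a (n + 1) | ℱ n]) ω - a n ω) 0
  have hc : ∀ n, StronglyMeasurable[ℱ n] (c n) := fun n => by
    have h1 : StronglyMeasurable[ℱ n] (μ[a (n + 1) | ℱ n]) := stronglyMeasurable_condExp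
    exact continuous_max.comp_stronglyMeasurable
      ((h1.sub (ha n)).prodMk stronglyMeasurable_const)
  have h1 := ae_tendsto_of_condExp_succ_le_add (μ := μ) ha hai ha0 hc
    (fun n ω => le_max_right _ _) fun n => Eventually.of_forall fun ω => by
      have := le_max_left ((μ[a (n + 1) | ℱ n]) ω - a n ω) 0
      change _ ≤ _ + max _ _
      linarith
  filter_upwards [h1, ae_all_iff.2 h] with ω h2 h3 hs
  exact h2 (hs.of_nonneg_of_le (fun n => le_max_right _ _) fun n =>
    max_le (by linarith [h3 n]) (hθ0 n ω))

/-! ### Metric projection and square-integrability -/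

/-- The projection is nonexpansive. Its continuity makes the projection of `x n` measurable with
respect to the past. -/
theorem Convex.exists_continuous_metric_projection {H : Type*} [NormedAddCommGroup H]
    [InnerProductSpace ℝ H] [CompleteSpace H] {Z : Set H} (hZ : Convex ℝ Z) (hZne : Z.Nonempty)
    (hZc : IsClosed Z) :
    ∃ P : H → H, Continuous P ∧ (∀ u, P u ∈ Z) ∧ ∀ u, ‖u - P u‖ = Metric.infDist u Z := by
  choose P hPZ hP using exists_norm_eq_iInf_of_complete_convex hZne hZc.isComplete hZ
  refine ⟨P, ?_, hPZ, fun u => ?_⟩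
  · refine (LipschitzWith.of_dist_le_mul (K := 1) fun u v => ?_).continuous
    have h1 := (norm_eq_iInf_iff_real_inner_le_zero hZ (hPZ u)).1 (hP u) _ (hPZ v)
    have h2 := (norm_eq_iInf_iff_real_inner_le_zero hZ (hPZ v)).1 (hP v) _ (hPZ u)
    -- Adding the two variational inequalities gives `‖P u - P v‖ ^ 2 ≤ inner ℝ (u - v) (P u - P
    -- v)`.
    have h3 : inner ℝ (u - P u) (P v - P u) + inner ℝ (v - P v) (P u - P v)
        = ‖P u - P v‖ ^ 2 - inner ℝ (u - v) (P u - P v) := by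
      rw [← real_inner_self_eq_norm_sq, ← neg_sub (P u) (P v), inner_neg_right,
        neg_add_eq_sub, ← inner_sub_left, ← inner_sub_left]
      congr 1; abel
    have h4 := real_inner_le_norm (u - v) (P u - P v)
    rw [dist_eq_norm, dist_eq_norm, NNReal.coe_one, one_mul]
    by_contra! h5
    have h6 : 0 < ‖P u - P v‖ := (norm_nonneg _).trans_lt h5
    nlinarith
  · rw [hP, Metric.infDist_eq_iInf]
    simp_rw [dist_eq_norm]

/-- Tonelli: the sum has finite expectation, hence is a.s. finite. -/
theorem ae_summable_of_summable_integral {Ω : Type*} {mΩ : MeasurableSpace Ω} {μ : Measure Ω}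
    {θ : ℕ → Ω → ℝ} (hθ : ∀ n, Integrable (θ n) μ) (hθ0 : ∀ n ω, 0 ≤ θ n ω)
    (hs : Summable fun n => ∫ ω, θ n ω ∂μ) : ∀ᵐ ω ∂μ, Summable fun n => θ n ω := by
  have h1 : ∑' n, ∫⁻ ω, ENNReal.ofReal (θ n ω) ∂μ ≠ ⊤ := by
    simp_rw [← fun n => ofReal_integral_eq_lintegral_ofReal (hθ n) (ae_of_all _ (hθ0 n))]
    exact hs.tsum_ofReal_ne_top
  rw [← lintegral_tsum fun n => (hθ n).aestronglyMeasurable.aemeasurable.ennreal_ofReal] at h1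
  filter_upwards [ae_lt_top' (AEMeasurable.tsum fun n =>
    (hθ n).aestronglyMeasurable.aemeasurable.ennreal_ofReal) h1] with ω hω
  refine (ENNReal.summable_toReal hω.ne).congr fun n => ?_
  rw [ENNReal.toReal_ofReal (hθ0 n ω)]

theorem MeasureTheory.MemLp.norm_toLp_sq {Ω H : Type*} [NormedAddCommGroup H]
    [InnerProductSpace ℝ H] {mΩ : MeasurableSpace Ω} {μ : Measure Ω} {f : Ω → H}
    (hf : MemLp f 2 μ) : ‖hf.toLp f‖ ^ 2 = ∫ ω, ‖f ω‖ ^ 2 ∂μ := by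
  rw [← real_inner_self_eq_norm_sq, L2.inner_def]
  refine integral_congr_ae ?_
  filter_upwards [hf.coeFn_toLp] with ω hω
  rw [hω, real_inner_self_eq_norm_sq]

theorem MeasureTheory.MemLp.integrable_norm_sq {Ω H : Type*} [NormedAddCommGroup H]
    {mΩ : MeasurableSpace Ω} {μ : Measure Ω} {f : Ω → H}
    (hf : MemLp f 2 μ) : Integrable (fun ω => ‖f ω‖ ^ 2) μ :=
  (memLp_two_iff_integrable_sq_norm hf.1).1 hf

theorem MeasureTheory.MemLp.integrable_inner {Ω H : Type*} [NormedAddCommGroup H]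
    [InnerProductSpace ℝ H] {mΩ : MeasurableSpace Ω} {μ : Measure Ω} {f g : Ω → H}
    (hf : MemLp f 2 μ) (hg : MemLp g 2 μ) : Integrable (fun ω => inner ℝ (f ω) (g ω)) μ := by
  refine (L2.integrable_inner (𝕜 := ℝ) (hf.toLp f) (hg.toLp g)).congr ?_
  filter_upwards [hf.coeFn_toLp, hg.coeFn_toLp] with ω h1 h2
  rw [h1, h2]

theorem MeasureTheory.MemLp.infDist {Ω H : Type*} [NormedAddCommGroup H]
    {mΩ : MeasurableSpace Ω} {μ : Measure Ω} [IsFiniteMeasure μ] {f : Ω → H} {p : ENNReal}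
    (hf : MemLp f p μ) {Z : Set H} (hZ : Z.Nonempty) :
    MemLp (fun ω => Metric.infDist (f ω) Z) p μ := by
  obtain ⟨z, hz⟩ := hZ
  refine (hf.sub (memLp_const z)).mono
    ((Metric.continuous_infDist_pt Z).comp_aestronglyMeasurable hf.1) (ae_of_all _ fun ω => ?_)
  rw [Real.norm_of_nonneg Metric.infDist_nonneg, Pi.sub_apply, ← dist_eq_norm]
  exact Metric.infDist_le_dist_of_mem hz

/-! ### From fixed to random points of the target set -/

/-- Pulling out the known factor `y` leaves an expression that, for fixed `ω`, is continuous in the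
value of `y`. -/
theorem condExp_norm_sub_sq_eq {Ω H : Type*} [NormedAddCommGroup H] [InnerProductSpace ℝ H]
    [CompleteSpace H] {m mΩ : MeasurableSpace Ω} {μ : Measure Ω} [IsFiniteMeasure μ]
    (hm : m ≤ mΩ) {u y : Ω → H} (hu : MemLp u 2 μ) (hy : MemLp y 2 μ)
    (hym : StronglyMeasurable[m] y) :
    ∀ᵐ ω ∂μ, (μ[fun ω => ‖u ω - y ω‖ ^ 2 | m]) ω
      = (μ[fun ω => ‖u ω‖ ^ 2 | m]) ω - 2 * inner ℝ (y ω) ((μ[u | m]) ω) + ‖y ω‖ ^ 2 := by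
  have hi := hy.integrable_inner hu
  have h1 := condExp_add (hu.integrable_norm_sq.sub (hi.const_mul 2)) hy.integrable_norm_sq m
  have h2 := condExp_sub hu.integrable_norm_sq (hi.const_mul 2) m
  have h3 := condExp_smul (μ := μ) (2 : ℝ) (fun ω => inner ℝ (y ω) (u ω)) m
  have h4 := condExp_bilin_of_stronglyMeasurable_left (μ := μ) (innerSL ℝ) hym (g := u)
    hi (hu.integrable one_le_two)
  have h5 := condExp_of_stronglyMeasurable hm (hym.norm.pow 2) hy.integrable_norm_sq
  have h6 : (fun ω => ‖u ω - y ω‖ ^ 2)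
      = (((fun ω => ‖u ω‖ ^ 2) - fun ω => 2 * inner ℝ (y ω) (u ω)) + fun ω => ‖y ω‖ ^ 2) := by
    funext ω
    simp only [Pi.add_apply, Pi.sub_apply, norm_sub_sq_real, real_inner_comm (u ω)]
  rw [h6]
  filter_upwards [h1, h2, h3, h4] with ω h1 h2 h3 h4
  change _ = inner ℝ (y ω) ((μ[u | m]) ω) at h4
  rw [h1, Pi.add_apply, h2, Pi.sub_apply]
  refine congrArg₂ _ (congrArg₂ _ rfl ?_) (congrFun h5 ω)
  exact h3.trans (by rw [Pi.smul_apply, smul_eq_mul]; exact congrArg _ h4)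

/-- A family of inequalities between conditional expectations of squared distances to the points
of `Z` transfers to random points of `Z`. -/
theorem condExp_norm_sub_sq_le_of_forall_mem {Ω H : Type*} [NormedAddCommGroup H]
    [InnerProductSpace ℝ H] [CompleteSpace H] [TopologicalSpace.SeparableSpace H]
    {m mΩ : MeasurableSpace Ω} {μ : Measure Ω} [IsFiniteMeasure μ]
    (hm : m ≤ mΩ) {Z : Set H} {u v y : Ω → H} {θ : Ω → ℝ} (hu : MemLp u 2 μ) (hy : MemLp y 2 μ)
    (hym : StronglyMeasurable[m] y) (hyZ : ∀ ω, y ω ∈ Z)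
    (h : ∀ z ∈ Z, ∀ᵐ ω ∂μ, (μ[fun ω => ‖u ω - z‖ ^ 2 | m]) ω ≤ ‖v ω - z‖ ^ 2 + θ ω) :
    ∀ᵐ ω ∂μ, (μ[fun ω => ‖u ω - y ω‖ ^ 2 | m]) ω ≤ ‖v ω - y ω‖ ^ 2 + θ ω := by
  -- The exceptional null set depends on `z`; a countable dense set leaves only one, and continuity
  -- in `z` then reaches every point of `Z`, including `y ω`.
  obtain ⟨D, hDZ, hDc, hD⟩ :=
    (TopologicalSpace.IsSeparable.of_separableSpace Z).exists_countable_dense_subset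
  have h1 : ∀ᵐ ω ∂μ, ∀ z ∈ D, (μ[fun ω => ‖u ω‖ ^ 2 | m]) ω
      - 2 * inner ℝ z ((μ[u | m]) ω) + ‖z‖ ^ 2 ≤ ‖v ω - z‖ ^ 2 + θ ω := by
    rw [ae_ball_iff hDc]
    intro z hz
    filter_upwards [h z (hDZ hz), condExp_norm_sub_sq_eq hm hu (memLp_const z)
      stronglyMeasurable_const] with ω h2 h3
    rwa [← h3]
  filter_upwards [h1, condExp_norm_sub_sq_eq hm hu hy hym] with ω h2 h3
  rw [h3]
  have h4 : IsClosed {z : H | (μ[fun ω => ‖u ω‖ ^ 2 | m]) ω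
      - 2 * inner ℝ z ((μ[u | m]) ω) + ‖z‖ ^ 2 ≤ ‖v ω - z‖ ^ 2 + θ ω} :=
    isClosed_le (by fun_prop) (by fun_prop)
  exact h4.closure_subset_iff.2 h2 (hD (hyZ ω))

theorem integral_le_of_condExp_le {Ω : Type*} {m mΩ : MeasurableSpace Ω} {μ : Measure Ω}
    [IsFiniteMeasure μ] (hm : m ≤ mΩ) {f g : Ω → ℝ} (hg : Integrable g μ)
    (h : ∀ᵐ ω ∂μ, (μ[f | m]) ω ≤ g ω) : ∫ ω, f ω ∂μ ≤ ∫ ω, g ω ∂μ := by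
  rw [← integral_condExp hm]
  exact integral_mono_ae integrable_condExp hg h

/-- Subtracting the partial sums of `e` leaves a decreasing sequence bounded below. -/
theorem exists_tendsto_of_succ_le_add {a e : ℕ → ℝ} (ha : ∀ n, 0 ≤ a n) (he : ∀ n, 0 ≤ e n)
    (hs : Summable e) (h : ∀ n, a (n + 1) ≤ a n + e n) : ∃ l : ℝ, Tendsto a atTop (𝓝 l) := by
  let b : ℕ → ℝ := fun n => a n - ∑ j ∈ Finset.range n, e j
  have hb : Antitone b := antitone_nat_of_succ_le fun n => by
    simp only [b, Finset.sum_range_succ]; linarith [h n]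
  have hbd : BddBelow (Set.range b) := by
    refine ⟨-∑' n, e n, ?_⟩
    rintro _ ⟨n, rfl⟩
    have := hs.sum_le_tsum (Finset.range n) fun j _ => he j
    simp only [b]; linarith [ha n]
  refine ⟨_, ((tendsto_atTop_ciInf hb hbd).add hs.hasSum.tendsto_sum_nat).congr fun n => ?_⟩
  simp [b]

/-! ### Stochastic quasi-Fejér sequences -/

/-- Sequences of square-integrable random variables which are stochastically quasi-Fejér
monotone in mean square, relative to every point of `Z`, with errors `θ` independent of the
point. -/
structure IsQuasiFejer {Ω H : Type*} {mΩ : MeasurableSpace Ω} [NormedAddCommGroup H]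
    (μ : Measure Ω) (ℱ : Filtration ℕ mΩ) (Z : Set H) (x : ℕ → Ω → H) (θ : ℕ → Ω → ℝ) :
    Prop where
  stronglyMeasurable : ∀ n, StronglyMeasurable[ℱ n] (x n)
  memLp : ∀ n, MemLp (x n) 2 μ
  nonneg : ∀ n ω, 0 ≤ θ n ω
  integrable : ∀ n, Integrable (θ n) μ
  condExp_le : ∀ n, ∀ z ∈ Z, ∀ᵐ ω ∂μ,
    (μ[fun ω => ‖x (n + 1) ω - z‖ ^ 2 | ℱ n]) ω ≤ ‖x n ω - z‖ ^ 2 + θ n ω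

namespace IsQuasiFejer

section Distance

variable {Ω H : Type*} {mΩ : MeasurableSpace Ω} [NormedAddCommGroup H] {μ : Measure Ω}
  {ℱ : Filtration ℕ mΩ} {Z : Set H} {x : ℕ → Ω → H} {θ : ℕ → Ω → ℝ}

theorem integrable_norm_sub_sq (hx : IsQuasiFejer μ ℱ Z x θ) {y : Ω → H} (hy : MemLp y 2 μ)
    (n : ℕ) : Integrable (fun ω => ‖x n ω - y ω‖ ^ 2) μ :=
  ((hx.memLp n).sub hy).integrable_norm_sq

theorem integral_nonneg (hx : IsQuasiFejer μ ℱ Z x θ) (n : ℕ) : 0 ≤ ∫ ω, θ n ω ∂μ :=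
  MeasureTheory.integral_nonneg (hx.nonneg n)

variable [IsFiniteMeasure μ]

theorem integrable_infDist_sq (hx : IsQuasiFejer μ ℱ Z x θ) (hZ : Z.Nonempty) (n : ℕ) :
    Integrable (fun ω => Metric.infDist (x n ω) Z ^ 2) μ :=
  ((hx.memLp n).infDist hZ).integrable_sq

theorem condExp_infDist_sq_le [TopologicalSpace.SeparableSpace H] (hx : IsQuasiFejer μ ℱ Z x θ)
    (hZ : Z.Nonempty) (n : ℕ) : ∀ᵐ ω ∂μ,
      (μ[fun ω => Metric.infDist (x (n + 1) ω) Z ^ 2 | ℱ n]) ω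
        ≤ Metric.infDist (x n ω) Z ^ 2 + θ n ω := by
  obtain ⟨D, hDZ, hDc, hD⟩ :=
    (TopologicalSpace.IsSeparable.of_separableSpace Z).exists_countable_dense_subset
  have h1 : ∀ᵐ ω ∂μ, ∀ z ∈ D, (μ[fun ω => Metric.infDist (x (n + 1) ω) Z ^ 2 | ℱ n]) ω
      ≤ ‖x n ω - z‖ ^ 2 + θ n ω := by
    rw [ae_ball_iff hDc]
    intro z hz
    have h2 := condExp_mono (m := ℱ n) (hx.integrable_infDist_sq hZ (n + 1))
      (hx.integrable_norm_sub_sq (memLp_const z) (n + 1)) (ae_of_all _ fun ω => by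
        refine pow_le_pow_left₀ Metric.infDist_nonneg ?_ 2
        rw [← dist_eq_norm]
        exact Metric.infDist_le_dist_of_mem (hDZ hz))
    filter_upwards [h2, hx.condExp_le n z (hDZ hz)] with ω h3 h4 using h3.trans h4
  filter_upwards [h1] with ω h2
  have h4 : IsClosed {z : H | (μ[fun ω => Metric.infDist (x (n + 1) ω) Z ^ 2 | ℱ n]) ω
      ≤ ‖x n ω - z‖ ^ 2 + θ n ω} := isClosed_le (by fun_prop) (by fun_prop)
  -- With `θ` moved to the left, square roots reduce the claim to a lower bound for the distance
  -- itself; `Real.sqrt` vanishes on negatives, so the sign of the difference is irrelevant.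
  rw [← sub_le_iff_le_add]
  refine (Real.sqrt_le_iff.1 ((Metric.le_infDist hZ).2 fun z hz => ?_)).2
  rw [dist_eq_norm, Real.sqrt_le_iff, sub_le_iff_le_add]
  exact ⟨norm_nonneg _, h4.closure_subset_iff.2 h2 (hD hz)⟩

theorem integral_infDist_sq_succ_le [TopologicalSpace.SeparableSpace H]
    (hx : IsQuasiFejer μ ℱ Z x θ) (hZ : Z.Nonempty) (n : ℕ) :
    ∫ ω, Metric.infDist (x (n + 1) ω) Z ^ 2 ∂μ
      ≤ ∫ ω, Metric.infDist (x n ω) Z ^ 2 ∂μ + ∫ ω, θ n ω ∂μ := by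
  rw [← integral_add (hx.integrable_infDist_sq hZ n) (hx.integrable n)]
  exact integral_le_of_condExp_le (ℱ.le n)
    ((hx.integrable_infDist_sq hZ n).add (hx.integrable n)) (hx.condExp_infDist_sq_le hZ n)

theorem ae_tendsto_infDist [TopologicalSpace.SeparableSpace H]
    (hx : IsQuasiFejer μ ℱ Z x θ) (hZ : Z.Nonempty) :
    ∀ᵐ ω ∂μ, Summable (fun n => θ n ω) →
      ∃ l : ℝ, Tendsto (fun n => Metric.infDist (x n ω) Z) atTop (𝓝 l) := by
  have h1 := ae_tendsto_of_condExp_succ_le_add' (μ := μ) (ℱ := ℱ)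
    (a := fun n ω => Metric.infDist (x n ω) Z ^ 2)
    (fun n => ((Metric.continuous_infDist_pt Z).comp_stronglyMeasurable
      (hx.stronglyMeasurable n)).pow 2) (hx.integrable_infDist_sq hZ) (fun n ω => sq_nonneg _)
    hx.nonneg (hx.condExp_infDist_sq_le hZ)
  filter_upwards [h1] with ω h2 hs
  obtain ⟨l, hl⟩ := h2 hs
  exact ⟨√l, hl.sqrt.congr fun n => Real.sqrt_sq Metric.infDist_nonneg⟩

theorem ae_tendsto_norm_sub (hx : IsQuasiFejer μ ℱ Z x θ) {z : H} (hz : z ∈ Z) :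
    ∀ᵐ ω ∂μ, Summable (fun n => θ n ω) →
      ∃ l : ℝ, Tendsto (fun n => ‖x n ω - z‖) atTop (𝓝 l) := by
  have h1 := ae_tendsto_of_condExp_succ_le_add' (μ := μ) (ℱ := ℱ)
    (a := fun n ω => ‖x n ω - z‖ ^ 2)
    (fun n => (((hx.stronglyMeasurable n).sub stronglyMeasurable_const).norm).pow 2)
    (hx.integrable_norm_sub_sq (memLp_const z)) (fun n ω => sq_nonneg _)
    hx.nonneg (fun n => hx.condExp_le n z hz)
  filter_upwards [h1] with ω h2 hs
  obtain ⟨l, hl⟩ := h2 hs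
  exact ⟨√l, hl.sqrt.congr fun n => Real.sqrt_sq (norm_nonneg _)⟩

theorem tendsto_integral_infDist_sq [TopologicalSpace.SeparableSpace H]
    (hx : IsQuasiFejer μ ℱ Z x θ) (hZ : Z.Nonempty) (hs : Summable fun n => ∫ ω, θ n ω ∂μ) :
    ∃ l : ℝ, Tendsto (fun n => ∫ ω, Metric.infDist (x n ω) Z ^ 2 ∂μ) atTop (𝓝 l) :=
  exists_tendsto_of_succ_le_add
    (fun _ => MeasureTheory.integral_nonneg fun _ => sq_nonneg _) hx.integral_nonneg hs
    (hx.integral_infDist_sq_succ_le hZ)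

/-- Almost sure convergence follows from almost sure convergence of a subsequence to a random
point of `Z`. -/
theorem ae_tendsto_of_subseq [TopologicalSpace.SeparableSpace H] (hx : IsQuasiFejer μ ℱ Z x θ)
    {y : Ω → H} (hyZ : ∀ ω, y ω ∈ Z) (hs : ∀ᵐ ω ∂μ, Summable fun n => θ n ω) {φ : ℕ → ℕ}
    (hφ : Tendsto φ atTop atTop)
    (hy : ∀ᵐ ω ∂μ, Tendsto (fun k => x (φ k) ω) atTop (𝓝 (y ω))) :
    ∀ᵐ ω ∂μ, Tendsto (fun n => x n ω) atTop (𝓝 (y ω)) := by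
  obtain ⟨D, hDZ, hDc, hD⟩ :=
    (TopologicalSpace.IsSeparable.of_separableSpace Z).exists_countable_dense_subset
  have h1 : ∀ᵐ ω ∂μ, ∀ z ∈ D, Summable (fun n => θ n ω) →
      ∃ l : ℝ, Tendsto (fun n => ‖x n ω - z‖) atTop (𝓝 l) :=
    (ae_ball_iff hDc).2 fun z hz => hx.ae_tendsto_norm_sub (hDZ hz)
  filter_upwards [h1, hs, hy] with ω h2 h3 h4
  rw [Metric.tendsto_nhds]
  intro ε hε
  obtain ⟨z, hz, hyz⟩ := Metric.mem_closure_iff.1 (hD (hyZ ω)) (ε / 2) (half_pos hε)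
  obtain ⟨l, hl⟩ := h2 z hz h3
  -- The whole sequence `‖x n ω - z‖` converges, so the subsequence identifies its limit, which is
  -- below `ε / 2`.
  have h5 : l = ‖y ω - z‖ :=
    tendsto_nhds_unique (hl.comp hφ) ((h4.sub_const z).norm)
  rw [dist_eq_norm, ← h5] at hyz
  filter_upwards [hl.eventually_lt_const hyz] with n hn
  calc dist (x n ω) (y ω) ≤ dist (x n ω) z + dist (y ω) z := dist_triangle_right _ _ _
    _ < ε := by rw [dist_eq_norm, dist_eq_norm, ← h5]; linarith

end Distance

section Hilbert

variable {Ω H : Type*} {mΩ : MeasurableSpace Ω} [NormedAddCommGroup H] [InnerProductSpace ℝ H]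
  [CompleteSpace H] [TopologicalSpace.SeparableSpace H] {μ : Measure Ω}
  {ℱ : Filtration ℕ mΩ} {Z : Set H} {x : ℕ → Ω → H} {θ : ℕ → Ω → ℝ} [IsFiniteMeasure μ]

/-- A point known at time `n` remains known later, so the one-step inequality applies to it at each
time `n + j` and can be iterated. -/
theorem integral_norm_sub_sq_add_le (hx : IsQuasiFejer μ ℱ Z x θ) {n : ℕ} {y : Ω → H}
    (hym : StronglyMeasurable[ℱ n] y) (hy : MemLp y 2 μ) (hyZ : ∀ ω, y ω ∈ Z) (k : ℕ) :
    ∫ ω, ‖x (n + k) ω - y ω‖ ^ 2 ∂μ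
      ≤ ∫ ω, ‖x n ω - y ω‖ ^ 2 ∂μ + ∑ j ∈ Finset.range k, ∫ ω, θ (n + j) ω ∂μ := by
  induction k with
  | zero => simp
  | succ k ih =>
    have h1 := condExp_norm_sub_sq_le_of_forall_mem (ℱ.le (n + k)) (hx.memLp (n + k + 1)) hy
      (hym.mono (ℱ.mono (Nat.le_add_right n k))) hyZ (hx.condExp_le (n + k))
    have h2 := integral_le_of_condExp_le (ℱ.le (n + k))
      ((hx.integrable_norm_sub_sq hy (n + k)).add (hx.integrable (n + k))) h1
    rw [integral_add' (hx.integrable_norm_sub_sq hy (n + k)) (hx.integrable (n + k))] at h2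
    rw [Finset.sum_range_succ, ← add_assoc]
    linarith

/-- Both iterates are compared with the projection of `x n` through `‖a - b‖² ≤ 2‖a‖² + 2‖b‖²`; each
comparison contributes `2 E d_Z²(x n)`, the first also the tail. -/
theorem integral_norm_sub_sq_le (hx : IsQuasiFejer μ ℱ Z x θ) (hZc : IsClosed Z)
    (hZ : Z.Nonempty) (hconv : Convex ℝ Z) (hs : Summable fun n => ∫ ω, θ n ω ∂μ) (n k : ℕ) :
    ∫ ω, ‖x (n + k) ω - x n ω‖ ^ 2 ∂μ
      ≤ 4 * ∫ ω, Metric.infDist (x n ω) Z ^ 2 ∂μ + 2 * ∑' j, ∫ ω, θ (n + j) ω ∂μ := by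
  obtain ⟨P, hPc, hPZ, hP⟩ := hconv.exists_continuous_metric_projection hZ hZc
  let y : Ω → H := fun ω => P (x n ω)
  have hym : StronglyMeasurable[ℱ n] y := hPc.comp_stronglyMeasurable (hx.stronglyMeasurable n)
  have hxy : MemLp (fun ω => x n ω - y ω) 2 μ :=
    ((hx.memLp n).infDist hZ).of_le
      (((hx.stronglyMeasurable n).sub hym).mono (ℱ.le n)).aestronglyMeasurable
      (ae_of_all _ fun ω => by
        rw [hP, Real.norm_of_nonneg Metric.infDist_nonneg])
  have hy : MemLp y 2 μ := by
    have := (hx.memLp n).sub hxy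
    convert this using 1
    funext ω
    simp
  have h1 := hx.integral_norm_sub_sq_add_le hym hy (fun ω => hPZ _) k
  have h2 : ∫ ω, ‖x n ω - y ω‖ ^ 2 ∂μ = ∫ ω, Metric.infDist (x n ω) Z ^ 2 ∂μ :=
    integral_congr_ae (ae_of_all _ fun ω => by simp only [y, hP])
  have h3 : ∑ j ∈ Finset.range k, ∫ ω, θ (n + j) ω ∂μ ≤ ∑' j, ∫ ω, θ (n + j) ω ∂μ := by
    refine Summable.sum_le_tsum _ (fun j _ => hx.integral_nonneg _) ?_
    simpa only [add_comm n] using (summable_nat_add_iff n).2 hs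
  have i1 := hx.integrable_norm_sub_sq hy (n + k)
  have i2 := hx.integrable_norm_sub_sq hy n
  calc ∫ ω, ‖x (n + k) ω - x n ω‖ ^ 2 ∂μ
      ≤ ∫ ω, (2 * ‖x (n + k) ω - y ω‖ ^ 2 + 2 * ‖x n ω - y ω‖ ^ 2) ∂μ := by
        refine integral_mono (hx.integrable_norm_sub_sq (hx.memLp n) (n + k))
          ((i1.const_mul 2).add (i2.const_mul 2)) fun ω => ?_
        have h4 := norm_sub_le (x (n + k) ω - y ω) (x n ω - y ω)
        rw [sub_sub_sub_cancel_right] at h4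
        have h5 := pow_le_pow_left₀ (norm_nonneg _) h4 2
        have h6 := sq_nonneg (‖x (n + k) ω - y ω‖ - ‖x n ω - y ω‖)
        dsimp only
        linarith
    _ = 2 * ∫ ω, ‖x (n + k) ω - y ω‖ ^ 2 ∂μ + 2 * ∫ ω, ‖x n ω - y ω‖ ^ 2 ∂μ := by
        rw [integral_add (i1.const_mul 2) (i2.const_mul 2), integral_const_mul,
          integral_const_mul]
    _ ≤ _ := by rw [h2] at h1 ⊢; linarith

/-- If the mean squared distances to `Z` vanish asymptotically, the sequence converges strongly,
in mean square and almost surely, to a `Z`-valued random variable. -/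
theorem exists_tendsto [MeasurableSpace H] [BorelSpace H] (hx : IsQuasiFejer μ ℱ Z x θ)
    (hZc : IsClosed Z) (hZ : Z.Nonempty) (hconv : Convex ℝ Z)
    (hs : Summable fun n => ∫ ω, θ n ω ∂μ)
    (h0 : Tendsto (fun n => ∫ ω, Metric.infDist (x n ω) Z ^ 2 ∂μ) atTop (𝓝 0)) :
    ∃ y : Ω → H, Measurable y ∧ (∀ ω, y ω ∈ Z) ∧ MemLp y 2 μ ∧
      Tendsto (fun n => eLpNorm (fun ω => x n ω - y ω) 2 μ) atTop (𝓝 0) ∧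
      (∀ᵐ ω ∂μ, Tendsto (fun n => x n ω) atTop (𝓝 (y ω))) ∧
      ∀ n, ∫ ω, ‖x n ω - y ω‖ ^ 2 ∂μ
        ≤ 4 * ∫ ω, Metric.infDist (x n ω) Z ^ 2 ∂μ + 2 * ∑' j, ∫ ω, θ (n + j) ω ∂μ := by
  let B : ℕ → ℝ := fun n =>
    4 * ∫ ω, Metric.infDist (x n ω) Z ^ 2 ∂μ + 2 * ∑' j, ∫ ω, θ (n + j) ω ∂μ
  have hB : Tendsto B atTop (𝓝 0) := by
    have h1 : Tendsto (fun n => ∑' j, ∫ ω, θ (n + j) ω ∂μ) atTop (𝓝 0) := by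
      simpa only [add_comm] using tendsto_sum_nat_add fun n => ∫ ω, θ n ω ∂μ
    simpa using (h0.const_mul 4).add (h1.const_mul 2)
  let X : ℕ → Lp H 2 μ := fun n => (hx.memLp n).toLp (x n)
  have hX : ∀ n k, ‖X (n + k) - X n‖ ^ 2 ≤ B n := fun n k => by
    rw [← MemLp.toLp_sub, MemLp.norm_toLp_sq]
    exact hx.integral_norm_sub_sq_le hZc hZ hconv hs n k
  have hcauchy : CauchySeq X := by
    rw [Metric.cauchySeq_iff']
    intro ε hε
    obtain ⟨N, hN⟩ := (hB.eventually_lt_const (pow_pos hε 2)).exists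
    refine ⟨N, fun n hn => ?_⟩
    obtain ⟨k, rfl⟩ := Nat.exists_eq_add_of_le hn
    rw [dist_eq_norm]
    exact lt_of_pow_lt_pow_left₀ 2 hε.le ((hX N k).trans_lt hN)
  obtain ⟨L, hL⟩ := cauchySeq_tendsto_of_complete hcauchy
  have hLm : StronglyMeasurable L := Lp.stronglyMeasurable L
  have hL2 : MemLp L 2 μ := Lp.memLp L
  have hLX : Tendsto (fun n => ∫ ω, ‖x n ω - L ω‖ ^ 2 ∂μ) atTop (𝓝 0) := by
    have h1 : Tendsto (fun n => ‖X n - L‖ ^ 2) atTop (𝓝 0) := by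
      simpa using (tendsto_iff_norm_sub_tendsto_zero.1 hL).pow 2
    refine h1.congr fun n => ?_
    have h2 : X n - L = ((hx.memLp n).sub hL2).toLp _ := by
      rw [MemLp.toLp_sub (hx.memLp n) hL2, Lp.toLp_coeFn]
    rw [h2, MemLp.norm_toLp_sq]
    rfl
  have hLZ : ∀ᵐ ω ∂μ, L ω ∈ Z := by
    have i0 : Integrable (fun ω => Metric.infDist (L ω) Z ^ 2) μ := (hL2.infDist hZ).integrable_sq
    -- The bound `d_Z(L)² ≤ 2 d_Z(x n)² + 2‖x n - L‖²` is integrated, and both terms vanish in the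
    -- limit.
    have h1 : ∫ ω, Metric.infDist (L ω) Z ^ 2 ∂μ ≤ 0 := by
      have h2 : Tendsto (fun n => 2 * ∫ ω, Metric.infDist (x n ω) Z ^ 2 ∂μ
          + 2 * ∫ ω, ‖x n ω - L ω‖ ^ 2 ∂μ) atTop (𝓝 0) := by
        simpa using (h0.const_mul 2).add (hLX.const_mul 2)
      refine ge_of_tendsto' h2 fun n => ?_
      have i1 := hx.integrable_infDist_sq hZ n
      have i2 := hx.integrable_norm_sub_sq hL2 n
      rw [← integral_const_mul, ← integral_const_mul,
        ← integral_add (i1.const_mul 2) (i2.const_mul 2)]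
      refine integral_mono i0 ((i1.const_mul 2).add (i2.const_mul 2)) fun ω => ?_
      have h3 : Metric.infDist (L ω) Z ≤ Metric.infDist (x n ω) Z + dist (L ω) (x n ω) :=
        Metric.infDist_le_infDist_add_dist
      rw [dist_comm, dist_eq_norm] at h3
      have h5 := pow_le_pow_left₀ Metric.infDist_nonneg h3 2
      have h6 := sq_nonneg (Metric.infDist (x n ω) Z - ‖x n ω - L ω‖)
      dsimp only
      linarith
    have h2 := (integral_eq_zero_iff_of_nonneg (fun ω => sq_nonneg _) i0).1
      (h1.antisymm (MeasureTheory.integral_nonneg fun ω => sq_nonneg _))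
    filter_upwards [h2] with ω hω
    exact (hZc.mem_iff_infDist_zero hZ).2 (pow_eq_zero_iff two_ne_zero |>.1 hω)
  classical
  obtain ⟨z, hz⟩ := hZ
  -- `L` is in `Z` only almost everywhere; it is redefined on the null set.
  let y : Ω → H := fun ω => if L ω ∈ Z then L ω else z
  have hyL : ∀ᵐ ω ∂μ, L ω = y ω := by
    filter_upwards [hLZ] with ω hω using (if_pos hω).symm
  have hyZ : ∀ ω, y ω ∈ Z := fun ω => by
    by_cases hω : L ω ∈ Z
    · simp only [y, if_pos hω, hω]
    · simp only [y, if_neg hω, hz]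
  have hy2 : MemLp y 2 μ := hL2.ae_eq hyL
  have hLy : L = hy2.toLp y := by
    rw [← Lp.toLp_coeFn L hL2]
    exact MemLp.toLp_congr _ _ hyL
  refine ⟨y, Measurable.ite (hLm.measurable hZc.measurableSet) hLm.measurable measurable_const,
    hyZ, hy2, ?_, ?_, fun n => ?_⟩
  · rw [hLy] at hL
    exact (Lp.tendsto_Lp_iff_tendsto_eLpNorm'' x hx.memLp y hy2).1 hL
  -- Convergence in `L²` implies convergence in measure, hence a.s. along a subsequence.
  · obtain ⟨φ, hφ, hφL⟩ := (tendstoInMeasure_of_tendsto_Lp hL).exists_seq_tendsto_ae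
    refine hx.ae_tendsto_of_subseq hyZ
      (ae_summable_of_summable_integral hx.integrable hx.nonneg hs) hφ.tendsto_atTop ?_
    filter_upwards [hφL, hyL, ae_all_iff.2 fun n => (hx.memLp n).coeFn_toLp] with ω h1 h2 h3
    rw [← h2]
    exact h1.congr fun k => h3 _
  · have h1 : ∫ ω, ‖x n ω - y ω‖ ^ 2 ∂μ = ‖L - X n‖ ^ 2 := by
      rw [norm_sub_rev, hLy, ← MemLp.toLp_sub, MemLp.norm_toLp_sq]
      rfl
    rw [h1]
    exact le_of_tendsto' ((((tendsto_add_atTop_iff_nat n).2 hL).sub_const (X n)).norm.pow 2)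
      fun k => by rw [add_comm k n]; exact hX n k

end Hilbert

end IsQuasiFejer

/-! ### The algorithm generates a quasi-Fejér sequence -/

theorem pastSigmaAlgebra_mono {Ω H : Type*} [TopologicalSpace H] (x : ℕ → Ω → H) :
    Monotone (pastSigmaAlgebra x) := fun _ _ hnm =>
  biSup_mono fun _ hj => hj.trans hnm

theorem pastSigmaAlgebra_le {Ω H : Type*} [mΩ : MeasurableSpace Ω] [TopologicalSpace H]
    [MeasurableSpace H] [BorelSpace H] {x : ℕ → Ω → H} (hx : ∀ n, Measurable (x n)) (n : ℕ) :
    pastSigmaAlgebra x n ≤ mΩ :=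
  iSup₂_le fun j _ => by
    rw [← BorelSpace.measurable_eq (α := H)]
    exact (hx j).comap_le

/-- The natural filtration of a sequence, expressed through `pastSigmaAlgebra`. -/
@[reducible] def pastFiltration {Ω H : Type*} [mΩ : MeasurableSpace Ω] [TopologicalSpace H]
    [MeasurableSpace H] [BorelSpace H] (x : ℕ → Ω → H) (hx : ∀ n, Measurable (x n)) :
    Filtration ℕ mΩ where
  seq := pastSigmaAlgebra x
  mono' := pastSigmaAlgebra_mono x
  le' := pastSigmaAlgebra_le hx

theorem measurable_pastSigmaAlgebra {Ω H : Type*} [TopologicalSpace H]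
    [MeasurableSpace H] [BorelSpace H] (x : ℕ → Ω → H) (n : ℕ) :
    Measurable[pastSigmaAlgebra x n] (x n) := by
  refine Measurable.of_comap_le (le_trans ?_ (le_iSup₂ (f := fun j (_ : j ≤ n) =>
    MeasurableSpace.comap (x j) (borel H)) n le_rfl))
  rw [← BorelSpace.measurable_eq (α := H)]

/-- The expansion is grouped so that the two conditional hypotheses of the algorithm control one
term each. -/
theorem norm_sub_smul_sub_sq {H : Type*} [NormedAddCommGroup H] [InnerProductSpace ℝ H]
    (x d z : H) (l : ℝ) :
    ‖x - l • d - z‖ ^ 2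
      = ‖x - z‖ ^ 2 + 2 * (l * inner ℝ (z + d - x) d) - l * (2 - l) * ‖d‖ ^ 2 := by
  have h1 : z + d - x = d - (x - z) := by abel
  rw [sub_right_comm, norm_sub_sq_real, inner_smul_right, norm_smul, mul_pow, h1,
    inner_sub_left d, real_inner_self_eq_norm_sq, Real.norm_eq_abs, sq_abs]
  ring

namespace IsGeneratedSequence

variable {Ω H : Type*} [mΩ : MeasurableSpace Ω] [NormedAddCommGroup H]
  [InnerProductSpace ℝ H] [MeasurableSpace H] {μ : Measure Ω} {Z : Set H} {x : ℕ → Ω → H}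
  {lam : ℕ → Ω → ℝ} {d : ℕ → Ω → H} {δ : ℕ → Ω → H → ℝ}

theorem memLp (hx : IsGeneratedSequence μ Z x lam d δ) (n : ℕ) : MemLp (x n) 2 μ := by
  induction n with
  | zero => exact hx.memLp_zero
  | succ n ih =>
    refine (ih.sub ((hx.memLp_d n).smul (r := 2) (hx.memLp_lam n))).ae_eq ?_
    filter_upwards [hx.update n] with ω hω using hω.symm

theorem condExp_norm_sub_sq_le [BorelSpace H] [IsFiniteMeasure μ]
    (hx : IsGeneratedSequence μ Z x lam d δ) (n : ℕ) {z : H} (hz : z ∈ Z)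
    (hxm : StronglyMeasurable[pastSigmaAlgebra x n] (x n)) :
    ∀ᵐ ω ∂μ, (μ[fun ω => ‖x (n + 1) ω - z‖ ^ 2 | pastSigmaAlgebra x n]) ω
      ≤ ‖x n ω - z‖ ^ 2 + δ n ω z := by
  have hld : MemLp (lam n • d n) 2 μ := (hx.memLp_d n).smul (r := 2) (hx.memLp_lam n)
  have i1 : Integrable (fun ω => ‖x n ω - z‖ ^ 2) μ :=
    ((hx.memLp n).sub (memLp_const z)).integrable_norm_sq
  have i2 : Integrable (fun ω => lam n ω * inner ℝ (z + d n ω - x n ω) (d n ω)) μ := by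
    -- The bounded factor `lam n` is absorbed into one side, giving an inner product of two `L²`
    -- functions.
    refine ((((memLp_const z).add (hx.memLp_d n)).sub (hx.memLp n)).integrable_inner
      hld).congr (ae_of_all _ fun ω => ?_)
    exact inner_smul_right _ _ _
  have i3 : Integrable (fun ω => lam n ω * (2 - lam n ω) * ‖d n ω‖ ^ 2) μ := by
    refine ((((hx.memLp_d n).const_smul (2 : ℝ)).sub hld).integrable_inner hld).congr
      (ae_of_all _ fun ω => ?_)
    change inner ℝ ((2 : ℝ) • d n ω - lam n ω • d n ω) (lam n ω • d n ω) = _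
    rw [← sub_smul, inner_smul_left, inner_smul_right, real_inner_self_eq_norm_sq]
    simp only [conj_trivial]
    ring
  have h0 : (fun ω => ‖x (n + 1) ω - z‖ ^ 2) =ᵐ[μ] ((fun ω => ‖x n ω - z‖ ^ 2)
      + (2 : ℝ) • fun ω => lam n ω * inner ℝ (z + d n ω - x n ω) (d n ω))
      - fun ω => lam n ω * (2 - lam n ω) * ‖d n ω‖ ^ 2 := by
    filter_upwards [hx.update n] with ω hω
    rw [hω, norm_sub_smul_sub_sq]
    rfl
  filter_upwards [condExp_congr_ae (m := pastSigmaAlgebra x n) h0,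
    condExp_sub (i1.add (i2.smul (2 : ℝ))) i3 (pastSigmaAlgebra x n),
    condExp_add i1 (i2.smul (2 : ℝ)) (pastSigmaAlgebra x n),
    condExp_smul (μ := μ) (2 : ℝ) (fun ω => lam n ω * inner ℝ (z + d n ω - x n ω) (d n ω))
      (pastSigmaAlgebra x n), hx.condExp_nonneg n, hx.condExp_le n z hz]
    with ω h1 h2 h3 h4 h5 h6
  have h7 := congrFun (condExp_of_stronglyMeasurable (μ := μ) (pastSigmaAlgebra_le hx.measurable n)
    ((hxm.sub stronglyMeasurable_const).norm.pow 2) i1) ω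
  have h8 : (μ[fun ω => ‖x n ω - z‖ ^ 2 | pastSigmaAlgebra x n]) ω = ‖x n ω - z‖ ^ 2 := h7
  rw [h1, h2, Pi.sub_apply, h3, Pi.add_apply, h4, h8, Pi.smul_apply, smul_eq_mul]
  linarith

theorem isQuasiFejer [BorelSpace H] [TopologicalSpace.SeparableSpace H] [IsFiniteMeasure μ]
    (hx : IsGeneratedSequence μ Z x lam d δ) (hδ : ∀ n ω z, δ n ω z = δ n ω 0) :
    IsQuasiFejer μ (pastFiltration x hx.measurable) Z x fun n ω => δ n ω 0 := by
  have : SecondCountableTopology H := UniformSpace.secondCountable_of_separable H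
  have hm : ∀ n, StronglyMeasurable[pastSigmaAlgebra x n] (x n) := fun n =>
    (measurable_pastSigmaAlgebra x n).stronglyMeasurable
  exact
    { stronglyMeasurable := hm
      memLp := hx.memLp
      nonneg := fun n ω => (hx.tolerance n).nonneg ω 0
      -- The integrability of the tolerance is tested at `y = 0`.
      integrable := fun n => (hx.tolerance n).integrable (fun _ => 0) MemLp.zero
      condExp_le := fun n z hz => by
        simpa only [hδ n _ z] using hx.condExp_norm_sub_sq_le n hz (hm n) }

end IsGeneratedSequence

/-! ### Geometric recursion and conclusion -/

theorem le_pow_mul_add_sum_of_succ_le {a e : ℕ → ℝ} {χ : ℝ} (hχ : 0 ≤ χ)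
    (h : ∀ n, a (n + 1) ≤ χ * a n + e n) (n : ℕ) :
    a n ≤ χ ^ n * a 0 + ∑ j ∈ Finset.range n, χ ^ (n - j - 1) * e j := by
  induction n with
  | zero => simp
  | succ n ih =>
    have h1 : ∑ j ∈ Finset.range n, χ ^ (n + 1 - j - 1) * e j
        = χ * ∑ j ∈ Finset.range n, χ ^ (n - j - 1) * e j := by
      rw [Finset.mul_sum]
      refine Finset.sum_congr rfl fun j hj => ?_
      have h2 : n + 1 - j - 1 = (n - j - 1) + 1 := by
        have := Finset.mem_range.1 hj
        omega
      rw [h2, pow_succ]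
      ring
    rw [Finset.sum_range_succ, h1, show n + 1 - n - 1 = 0 by omega, pow_succ, pow_zero]
    linarith [h n, mul_le_mul_of_nonneg_left ih hχ]

theorem theorem3p2 {Ω H : Type*} [MeasurableSpace Ω] [NormedAddCommGroup H]
    [InnerProductSpace ℝ H] [CompleteSpace H] [TopologicalSpace.SeparableSpace H]
    [MeasurableSpace H] [BorelSpace H]
    (μ : Measure Ω) [IsProbabilityMeasure μ]
    (Z : Set H) (hZne : Z.Nonempty) (hZc : IsClosed Z)
    (x : ℕ → Ω → H) (lam : ℕ → Ω → ℝ) (d : ℕ → Ω → H) (δ : ℕ → Ω → H → ℝ)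
    (hx : IsGeneratedSequence μ Z x lam d δ)
    (ϑ : ℕ → Ω → ℝ) (hδ : ∀ n ω z, δ n ω z = δ n ω 0) (hϑ : ∀ n ω, ϑ n ω = δ n ω 0) :
    -- the iterates are square-integrable, so that all the expectations below are finite
    (∀ n, MemLp (x n) 2 μ) ∧
    -- (i)
    (∀ n, ∀ᵐ ω ∂μ,
      (μ[fun ω => Metric.infDist (x (n + 1) ω) Z ^ 2 | pastSigmaAlgebra x n]) ω
        ≤ Metric.infDist (x n ω) Z ^ 2 + ϑ n ω) ∧
    -- (ii)
    (∀ n, ∫ ω, Metric.infDist (x (n + 1) ω) Z ^ 2 ∂μ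
        ≤ ∫ ω, Metric.infDist (x n ω) Z ^ 2 ∂μ + ∫ ω, ϑ n ω ∂μ) ∧
    -- (iii)
    ((∀ᵐ ω ∂μ, Summable fun n => ϑ n ω) →
      ∀ᵐ ω ∂μ, ∃ l : ℝ, Tendsto (fun n => Metric.infDist (x n ω) Z) atTop (𝓝 l)) ∧
    -- (iv)
    ((Summable fun n => ∫ ω, ϑ n ω ∂μ) →
      -- (a)
      (∃ l : ℝ, Tendsto (fun n => ∫ ω, Metric.infDist (x n ω) Z ^ 2 ∂μ) atTop (𝓝 l)) ∧
      -- (b)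
      (Convex ℝ Z →
        liminf (fun n => ∫ ω, Metric.infDist (x n ω) Z ^ 2 ∂μ) atTop = 0 →
        ∃ xlim : Ω → H, Measurable xlim ∧ (∀ ω, xlim ω ∈ Z) ∧ MemLp xlim 2 μ ∧
          Tendsto (fun n => eLpNorm (fun ω => x n ω - xlim ω) 2 μ) atTop (𝓝 0) ∧
          ∀ᵐ ω ∂μ, Tendsto (fun n => x n ω) atTop (𝓝 (xlim ω))) ∧
      -- (c)
      (Convex ℝ Z → ∀ χ : ℝ, 0 < χ → χ < 1 →
        (∀ n, ∀ᵐ ω ∂μ,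
          (μ[fun ω => Metric.infDist (x (n + 1) ω) Z ^ 2 | pastSigmaAlgebra x n]) ω
            ≤ χ * Metric.infDist (x n ω) Z ^ 2 + ϑ n ω) →
        -- [A]
        (∀ n, ∫ ω, Metric.infDist (x (n + 1) ω) Z ^ 2 ∂μ
          ≤ χ ^ (n + 1) * ∫ ω, Metric.infDist (x 0 ω) Z ^ 2 ∂μ
            + ∑ j ∈ Finset.range (n + 1), χ ^ (n - j) * ∫ ω, ϑ j ω ∂μ) ∧
        -- [B]
        (∃ xlim : Ω → H, Measurable xlim ∧ (∀ ω, xlim ω ∈ Z) ∧ MemLp xlim 2 μ ∧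
          Tendsto (fun n => eLpNorm (fun ω => x n ω - xlim ω) 2 μ) atTop (𝓝 0) ∧
          (∀ᵐ ω ∂μ, Tendsto (fun n => x n ω) atTop (𝓝 (xlim ω))) ∧
          ∀ n, ∫ ω, ‖x n ω - xlim ω‖ ^ 2 ∂μ
            ≤ 4 * χ ^ n * ∫ ω, Metric.infDist (x 0 ω) Z ^ 2 ∂μ
              + 4 * ∑ j ∈ Finset.range n, χ ^ (n - j - 1) * ∫ ω, ϑ j ω ∂μ
              + 2 * ∑' j, ∫ ω, ϑ (n + j) ω ∂μ))) := by
  obtain rfl : ϑ = fun n ω => δ n ω 0 := funext fun n => funext fun ω => hϑ n ω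
  have hq := hx.isQuasiFejer hδ
  refine ⟨hx.memLp, hq.condExp_infDist_sq_le hZne, hq.integral_infDist_sq_succ_le hZne,
    fun hs => ?_, fun hs => ⟨hq.tendsto_integral_infDist_sq hZne hs, fun hconv h0 => ?_,
      fun hconv χ hχ0 hχ1 hχ => ?_⟩⟩
  · filter_upwards [hs, hq.ae_tendsto_infDist hZne] with ω h1 h2 using h2 h1
  -- The full limit exists by (a), so it equals the lower limit.
  · obtain ⟨l, hl⟩ := hq.tendsto_integral_infDist_sq hZne hs
    rw [hl.liminf_eq] at h0
    rw [h0] at hl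
    obtain ⟨y, h1, h2, h3, h4, h5, -⟩ := hq.exists_tendsto hZc hZne hconv hs hl
    exact ⟨y, h1, h2, h3, h4, h5⟩
  · have hrec : ∀ n, ∫ ω, Metric.infDist (x (n + 1) ω) Z ^ 2 ∂μ
        ≤ χ * ∫ ω, Metric.infDist (x n ω) Z ^ 2 ∂μ + ∫ ω, δ n ω 0 ∂μ := fun n => by
      rw [← integral_const_mul,
        ← integral_add ((hq.integrable_infDist_sq hZne n).const_mul χ) (hq.integrable n)]
      exact integral_le_of_condExp_le (pastSigmaAlgebra_le hx.measurable n)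
        (((hq.integrable_infDist_sq hZne n).const_mul χ).add (hq.integrable n)) (hχ n)
    have hbound := le_pow_mul_add_sum_of_succ_le
      (a := fun n => ∫ ω, Metric.infDist (x n ω) Z ^ 2 ∂μ) hχ0.le hrec
    obtain ⟨l, hl⟩ := hq.tendsto_integral_infDist_sq hZne hs
    have hl0 : l = 0 := by
      have h1 : 0 ≤ l := ge_of_tendsto' hl fun n => integral_nonneg fun ω => sq_nonneg _
      -- The recursion in the limit reads `l ≤ χ * l`, with `χ < 1`.
      have h2 : l ≤ χ * l + 0 := le_of_tendsto_of_tendsto' ((tendsto_add_atTop_iff_nat 1).2 hl)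
        ((hl.const_mul χ).add hs.tendsto_atTop_zero) hrec
      nlinarith
    rw [hl0] at hl
    obtain ⟨y, h1, h2, h3, h4, h5, h6⟩ := hq.exists_tendsto hZc hZne hconv hs hl
    refine ⟨fun n => ?_, y, h1, h2, h3, h4, h5, fun n => (h6 n).trans ?_⟩
    · refine (hbound (n + 1)).trans_eq (congrArg _ (Finset.sum_congr rfl fun j hj => ?_))
      rw [show n + 1 - j - 1 = n - j by omega]
    · have h7 := hbound n
      linarith
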